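/- Let $p$ be a prime, let $\mathsf{k}$ be a field of characteristic $p$, and let $a\ge 3$ be an integer. Let $\mathcal{F}=\mathsf{k}(x_1,x_2,x_3)$ be a purely transcendental extension of $\mathsf{k}$ with algebraically independent generators $x_1,x_2,x_3$, and let $\mathsf{Q}$ be the quiver with three vertices $1,2,3$, all mutable, having exactly $a$ arrows $1\to 2$, $a$ arrows $2\to 3$, $a$ arrows $3\to 1$ and no other arrows. Mutating a seed $(\mathsf{Q}',\mathbf{y})$ at a vertex $v$ replaces $y_v$ by $$\Big(\prod_{i\to v} y_i+\prod_{v\to i} y_i\Big)y_v^{-1}$$ (products over all arrows of $\mathsf{Q}'$ into, respectively out of, $v$), leaves the other $y_i$ unchanged, and replaces $\mathsf{Q}'$ by the quiver obtained by adding an arrow $i\to j$ for each pair of arrows $i\to v\to j$, then reversing every arrow incident to $v$, then cancelling directed 2-cycles in pairs. Let $\mathcal{A}=\mathcal{A}(\mathsf{Q},\mathbf{x})\subset\mathcal{F}$ be the cluster algebra, i.e. the $\mathsf{k}$-subalgebra generated by all elements of all clusters of seeds obtained from $(\mathsf{Q},(x_1,x_2,x_3))$ by finite sequences of mutations. For a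 domain $R$ of characteristic $p$ and $e\in\mathbb{N}$, let $R^{1/p^e}$ denote the overring of $p^e$-th roots of elements of $R$, regarded as an $R$-module. Call $R$ strongly $F$-regular if for every nonzero $c\in R$ there are $e\in\mathbb{N}$ and $\psi\in\operatorname{Hom}_R(R^{1/p^e},R)$ with $\psi(c^{1/p^e})=1$. (Finite generation of $R^{1/p}$ over $R$ is not made part of this condition.) Then $\mathcal{A}$ is not strongly $F$-regular: there is a nonzero $c\in\mathcal{A}$ such that $\psi(c^{1/p^e})\neq 1$ for every $e\in\mathbb{N}$ and every $\psi\in\operatorname{Hom}_{\mathcal{A}}(\mathcal{A}^{1/p^e},\mathcal{A})$. -/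

import Mathlib

/-! ### Cluster algebras of quivers -/

namespace ClusterAlgebra

/-- A quiver on the vertex set `I` without loops or directed 2-cycles, recorded by the number
`arrows i j` of arrows `i → j`. -/
@[ext]
structure ClusterQuiver (I : Type*) where
  arrows : I → I → ℕ
  no_loop : ∀ i, arrows i i = 0
  no_two_cycle : ∀ i j, arrows i j = 0 ∨ arrows j i = 0

namespace ClusterQuiver

variable {I : Type*} [DecidableEq I]

/-- First step of mutation at `v`: for each pair of arrows `i → v → j` add an arrow `i → j`. -/
def addComposites (v : I) (m : I → I → ℕ) : I → I → ℕ :=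
  fun i j => m i j + m i v * m v j

/-- Second step of mutation at `v`: reverse every arrow incident to `v`. -/
def reverseAt (v : I) (m : I → I → ℕ) : I → I → ℕ :=
  fun i j => if i = v ∨ j = v then m j i else m i j

/-- Third step of mutation: cancel directed 2-cycles in pairs. Truncated subtraction is intended:
of `m i j` arrows `i → j` and `m j i` arrows `j → i`, exactly `min (m i j) (m j i)` pairs are
removed. -/
def cancelTwoCycles (m : I → I → ℕ) : I → I → ℕ :=
  fun i j => m i j - m j i

/-- Mutation of a quiver at the vertex `v`. -/
def mutate (Q : ClusterQuiver I) (v : I) : ClusterQuiver I where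
  arrows := cancelTwoCycles (reverseAt v (addComposites v Q.arrows))
  no_loop i := by simp [cancelTwoCycles]
  no_two_cycle i j := by
    simp only [cancelTwoCycles]
    omega

/-- A vertex is isolated if no arrow touches it. -/
def IsIsolated {I : Type*} (Q : ClusterQuiver I) (i : I) : Prop :=
  ∀ j, Q.arrows i j = 0 ∧ Q.arrows j i = 0

theorem isIsolated_of_mutate (Q : ClusterQuiver I) (v i : I) (h : (Q.mutate v).IsIsolated i) :
    Q.IsIsolated i := by
  have hv := Q.no_loop v
  have key : Q.arrows i v = 0 ∧ Q.arrows v i = 0 := by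
    have h1 := h v
    have h2 := Q.no_two_cycle i v
    simp only [mutate, cancelTwoCycles, reverseAt, addComposites, hv, or_true, true_or, if_true,
      mul_zero, zero_mul, add_zero] at h1
    omega
  intro j
  have h1 := h j
  have h2 := Q.no_two_cycle i j
  have h3 := Q.no_two_cycle j v
  by_cases hj : j = v
  · subst hj; exact key
  by_cases hi : i = v
  · subst hi
    simp only [mutate, cancelTwoCycles, reverseAt, addComposites, hv, or_true, true_or, if_true,
      mul_zero, zero_mul, add_zero] at h1
    omega
  · simp only [mutate, cancelTwoCycles, reverseAt, addComposites, hi, hj, or_self, if_false,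
      key.1, key.2, mul_zero, zero_mul, add_zero] at h1
    omega

end ClusterQuiver

/-- A seed, with vertex set `I`, for the field `F` over the field `k`: a quiver without loops or
2-cycles, algebraically independent generators `x i` of the field extension `F / k` indexed by the
vertices, and a set of frozen vertices that contains every vertex which touches no arrow. -/
structure Seed (k F I : Type*) [Field k] [Field F] [Algebra k F] where
  quiver : ClusterQuiver I
  x : I → F
  algebraicIndependent : AlgebraicIndependent k x
  adjoin_eq_top : IntermediateField.adjoin k (Set.range x) = ⊤
  frozen : Set I
  frozen_of_isIsolated : ∀ i, quiver.IsIsolated i → i ∈ frozen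

namespace Seed

variable {k F I : Type*} [Field k] [Field F] [Algebra k F] [Fintype I]

/-- The numerator `∏_{i → v} x_i + ∏_{v → i} x_i` of the mutation formula, with the products over
all arrows into, respectively out of, `v`. -/
noncomputable def exchangeNumerator (S : Seed k F I) (v : I) : F :=
  ∏ i, S.x i ^ S.quiver.arrows i v + ∏ i, S.x i ^ S.quiver.arrows v i

theorem exchangeNumerator_ne_zero (S : Seed k F I) (v : I) (hv : v ∉ S.frozen) :
    S.exchangeNumerator v ≠ 0 := by
  classical
  let b : I →₀ ℕ := Finsupp.equivFunOnFinite.symm fun i => S.quiver.arrows i v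
  let c : I →₀ ℕ := Finsupp.equivFunOnFinite.symm fun i => S.quiver.arrows v i
  have hbc : c ≠ b := by
    intro h
    apply hv
    apply S.frozen_of_isIsolated
    intro j
    have h1 : S.quiver.arrows v j = S.quiver.arrows j v := DFunLike.congr_fun h j
    have h2 := S.quiver.no_two_cycle v j
    omega
  have hE : S.exchangeNumerator v =
      MvPolynomial.aeval S.x (MvPolynomial.monomial b (1 : k) + MvPolynomial.monomial c 1) := by
    simp [exchangeNumerator, MvPolynomial.aeval_monomial, Finsupp.prod_fintype, b, c]
  intro h0
  rw [hE, ← map_zero (MvPolynomial.aeval S.x : MvPolynomial I k →ₐ[k] F)] at h0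
  have h1 := congrArg (MvPolynomial.coeff b) (S.algebraicIndependent h0)
  simp [MvPolynomial.coeff_monomial, hbc] at h1

variable [DecidableEq I]

/-- The cluster obtained by mutation at `v`: the variable `x_v` is replaced by
`(∏_{i → v} x_i + ∏_{v → i} x_i) x_v⁻¹`. -/
noncomputable def mutatedCluster (S : Seed k F I) (v : I) : I → F :=
  Function.update S.x v (S.exchangeNumerator v * (S.x v)⁻¹)

theorem adjoin_mutatedCluster (S : Seed k F I) (v : I) (hv : v ∉ S.frozen) :
    IntermediateField.adjoin k (Set.range (S.mutatedCluster v)) = ⊤ := by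
  rw [eq_top_iff, ← S.adjoin_eq_top, IntermediateField.adjoin_le_iff]
  set K := IntermediateField.adjoin k (Set.range (S.mutatedCluster v)) with hK
  have hmem : ∀ i, S.mutatedCluster v i ∈ K := fun i =>
    IntermediateField.subset_adjoin k _ ⟨i, rfl⟩
  have hne : ∀ i, i ≠ v → S.x i ∈ K := fun i hi => by
    have := hmem i
    rwa [mutatedCluster, Function.update_of_ne hi] at this
  have hl := S.quiver.no_loop v
  have hnum : S.exchangeNumerator v ∈ K := by
    refine K.add_mem (K.prod_mem fun i _ => ?_) (K.prod_mem fun i _ => ?_)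
    all_goals
      by_cases hi : i = v
      · subst hi; rw [hl, pow_zero]; exact K.one_mem
      · exact pow_mem (hne i hi) _
  rintro _ ⟨i, rfl⟩
  by_cases hi : i = v
  · subst hi
    have h1 := hmem i
    rw [mutatedCluster, Function.update_self] at h1
    have h2 := K.mul_mem hnum (K.inv_mem h1)
    have h3 := S.exchangeNumerator_ne_zero i hv
    have h4 : S.exchangeNumerator i * (S.exchangeNumerator i * (S.x i)⁻¹)⁻¹ = S.x i := by
      rw [mul_inv, inv_inv, ← mul_assoc, mul_inv_cancel₀ h3, one_mul]
    rwa [h4] at h2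
  · exact hne i hi

theorem algebraicIndependent_mutatedCluster (S : Seed k F I) (v : I) (hv : v ∉ S.frozen) :
    AlgebraicIndependent k (S.mutatedCluster v) := by
  have halg : ∀ y : I → F, IntermediateField.adjoin k (Set.range y) = ⊤ →
      Algebra.IsAlgebraic (Algebra.adjoin k (Set.range y)) F := by
    intro y hy
    refine ⟨fun z => ?_⟩
    have hz : z ∈ IntermediateField.adjoin k (Set.range y) := hy ▸ IntermediateField.mem_top
    obtain ⟨r, hr, s, hs, rfl⟩ := IntermediateField.mem_adjoin_iff_div.mp hz
    rw [div_eq_mul_inv]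
    exact (isAlgebraic_algebraMap (⟨r, hr⟩ : Algebra.adjoin k (Set.range y))).mul
      (isAlgebraic_algebraMap (⟨s, hs⟩ : Algebra.adjoin k (Set.range y))).inv
  have := halg _ (S.adjoin_mutatedCluster v hv)
  exact (Algebra.IsAlgebraic.isTranscendenceBasis_of_lift_le_trdeg_of_finite k _
    S.algebraicIndependent.lift_cardinalMk_le_trdeg).1

/-- Mutation of a seed at a mutable (that is, not frozen) vertex. Frozen vertices stay frozen. -/
noncomputable def mutate (S : Seed k F I) (v : I) (hv : v ∉ S.frozen) : Seed k F I where
  quiver := S.quiver.mutate v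
  x := S.mutatedCluster v
  algebraicIndependent := S.algebraicIndependent_mutatedCluster v hv
  adjoin_eq_top := S.adjoin_mutatedCluster v hv
  frozen := S.frozen
  frozen_of_isIsolated i hi :=
    S.frozen_of_isIsolated i (S.quiver.isIsolated_of_mutate v i hi)

/-- Two seeds are mutation-equivalent if they are related by a finite sequence of mutations. -/
def MutationEquivalent : Seed k F I → Seed k F I → Prop :=
  Relation.ReflTransGen fun S T => ∃ (v : I) (hv : v ∉ S.frozen), T = S.mutate v hv

/-- The set of all cluster variables: the union of the clusters of all seeds that are
mutation-equivalent to `S`. -/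
def clusterVariables (S : Seed k F I) : Set F :=
  {z | ∃ T : Seed k F I, S.MutationEquivalent T ∧ ∃ i, z = T.x i}

/-- The cluster algebra of `S`: the `k`-subalgebra of `F` generated by all cluster variables and the
inverses of the frozen variables. -/
def clusterAlgebra (S : Seed k F I) : Subalgebra k F :=
  Algebra.adjoin k (S.clusterVariables ∪ {z | ∃ i ∈ S.frozen, z = (S.x i)⁻¹})

end Seed

/-- The quiver on three vertices with `a` arrows `0 → 1`, `a` arrows `1 → 2`, `a` arrows `2 → 0`
and no others. -/
def markovQuiver (a : ℕ) : ClusterQuiver (Fin 3) where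
  arrows i j := if j = i + 1 then a else 0
  no_loop i := by fin_cases i <;> simp
  no_two_cycle i j := by fin_cases i <;> fin_cases j <;> simp

/-- The generalized Markov seed for an integer `a ≥ 2`: three mutable vertices, no frozen ones. -/
def markovSeed {k F : Type*} [Field k] [Field F] [Algebra k F] (a : ℕ) (ha : 2 ≤ a)
    (x : Fin 3 → F) (hx : AlgebraicIndependent k x)
    (hgen : IntermediateField.adjoin k (Set.range x) = ⊤) : Seed k F (Fin 3) where
  quiver := markovQuiver a
  x := x
  algebraicIndependent := hx
  adjoin_eq_top := hgen
  frozen := ∅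
  frozen_of_isIsolated i hi := by
    have h := (hi (i + 1)).1
    simp only [markovQuiver, if_true] at h
    omega

end ClusterAlgebra

/-! ### Strong F-regularity -/

namespace FrobeniusRegularity

/-- The ring `R^{1/p^e}`: a copy of `R`, regarded as an `R`-algebra through the `e`-th iterate
`r ↦ r ^ p ^ e` of the Frobenius endomorphism. -/
def FrobeniusRoot (R : Type*) (_p _e : ℕ) : Type _ := R

namespace FrobeniusRoot

variable (R : Type*) [CommRing R] (p e : ℕ)

instance : CommRing (FrobeniusRoot R p e) := inferInstanceAs (CommRing R)

/-- The canonical ring isomorphism `R ≃ R^{1/p^e}`, sending `r` to the element written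
`r^{1/p^e}`. -/
def root : R ≃+* FrobeniusRoot R p e := RingEquiv.refl R

variable [ExpChar R p]

/-- The inclusion `R → R^{1/p^e}`, sending `r` to `(r^{p^e})^{1/p^e}`. -/
instance : Algebra R (FrobeniusRoot R p e) :=
  ((root R p e : R →+* FrobeniusRoot R p e).comp (iterateFrobenius R p e)).toAlgebra

/-- The module structure is `r • y^{1/p^e} = (r^{p^e} y)^{1/p^e}`. -/
theorem smul_root (r y : R) : r • root R p e y = root R p e (r ^ p ^ e * y) := rfl

end FrobeniusRoot

/-- Strong F-regularity of a domain `R` of prime characteristic `p`: for every nonzero `c` there are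
`e` and an `R`-linear map `ψ : R^{1/p^e} → R` with `ψ (c^{1/p^e}) = 1`.  Finite generation of
`R^{1/p}` over `R` is not part of this predicate, so its negation says that the splitting
condition itself fails. -/
def StronglyFRegular (p : ℕ) [Fact p.Prime] (R : Type*) [CommRing R] [IsDomain R] [CharP R p] :
    Prop :=
  ∀ c : R, c ≠ 0 → ∃ (e : ℕ) (ψ : FrobeniusRoot R p e →ₗ[R] R),
    ψ (FrobeniusRoot.root R p e c) = 1

/-- A subalgebra of a field extension of `k` has the characteristic of `k`. -/
instance charP_subalgebra (p : ℕ) {k F : Type*} [Field k] [CharP k p] [Field F] [Algebra k F]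
    (A : Subalgebra k F) : CharP A p :=
  charP_of_injective_algebraMap (algebraMap k A).injective p

end FrobeniusRegularity

/-! The test element is `c = x 0`. Identifying `R^{1/p^e}` with `R`, a map `ψ` becomes an additive
map with `ψ (r ^ q * y) = r * ψ y`, `q = p ^ e`. It extends to a map `Ψ` of the fraction field, and
`Ψ` preserves every Laurent ring `L` whose cluster lies in `A` and which contains `A`. By the
Laurent phenomenon this applies to the initial cluster and its three neighbours, and these four
suffice.

Suppose `Ψ (x i) = 1`. Let `σ α` be the constant term of `Ψ (x^α)`. Its support is finite, since `Ψ
(x^(ρ + qβ)) = x^β Ψ (x^ρ)` with `ρ` in a finite box. On the plane of total degree 1 the support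
contains the `i`-th unit vector. Among its points there, let `m ≥ 1` be the largest coordinate that
occurs, at position `v`, and fix that coordinate. With `y, z` the other two variables and `x_v'` the
exchanged one, `x_v^m = (y^a + z^a)^m x_v'^(-m)`. A single functional serves as constant term for
both clusters, so along the line `x_v^m y^(b+t) z^(d-t)` the function `σ` is a Laurent polynomial in
`t` divisible by `(1 + T^a)^m`, and its support has width at least `a m`. Since all coordinates are
at most `m` and `b + d = 1 - m`, this gives `a m + 1 ≤ 3 m`, impossible for `a ≥ 3`.

The Laurent phenomenon (`run_mem_laurent`) is the comaximality argument of Fomin and Zelevinsky.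
Here all quivers reached are cyclic triangles, so a seed reduces to three variables and three
multiplicities. -/

namespace LaurentPhenomenon

/-! ### Localisations of subalgebras and comaximality -/

variable {k F : Type*} [Field k] [Field F] [Algebra k F]

/-- The Laurent polynomials in the `x i`, as a subalgebra of the field `F`. -/
def laurent (k : Type*) {F ι : Type*} [Field k] [Field F] [Algebra k F] (x : ι → F) :
    Subalgebra k F :=
  Algebra.adjoin k (Set.range x ∪ Set.range fun i => (x i)⁻¹)

theorem mem_laurent {ι : Type*} (x : ι → F) (i : ι) : x i ∈ laurent k x :=
  Algebra.subset_adjoin (Or.inl ⟨i, rfl⟩)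

theorem inv_mem_laurent {ι : Type*} (x : ι → F) (i : ι) : (x i)⁻¹ ∈ laurent k x :=
  Algebra.subset_adjoin (Or.inr ⟨i, rfl⟩)

theorem laurent_le {ι : Type*} {x : ι → F} {B : Subalgebra k F} (h : ∀ i, x i ∈ B)
    (h' : ∀ i, (x i)⁻¹ ∈ B) : laurent k x ≤ B := by
  refine Algebra.adjoin_le ?_
  rintro _ (⟨i, rfl⟩ | ⟨i, rfl⟩)
  exacts [h i, h' i]

/-- The elements of `F` that a power of `w` multiplies into `B`. -/
def away (B : Subalgebra k F) (w : F) (hw : w ∈ B) : Subalgebra k F where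
  carrier := {z | ∃ n : ℕ, z * w ^ n ∈ B}
  mul_mem' := by
    rintro y z ⟨m, hm⟩ ⟨n, hn⟩
    refine ⟨m + n, ?_⟩
    have : y * z * w ^ (m + n) = (y * w ^ m) * (z * w ^ n) := by ring
    rw [this]
    exact B.mul_mem hm hn
  add_mem' := by
    rintro y z ⟨m, hm⟩ ⟨n, hn⟩
    refine ⟨m + n, ?_⟩
    have : (y + z) * w ^ (m + n) = (y * w ^ m) * w ^ n + (z * w ^ n) * w ^ m := by ring
    rw [this]
    exact B.add_mem (B.mul_mem hm (B.pow_mem hw n)) (B.mul_mem hn (B.pow_mem hw m))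
  algebraMap_mem' r := ⟨0, by simp⟩

theorem le_away (B : Subalgebra k F) (w : F) (hw : w ∈ B) : B ≤ away B w hw :=
  fun z hz => ⟨0, by simpa using hz⟩

theorem mem_away {B : Subalgebra k F} {w : F} {hw : w ∈ B} {z : F} (h : z * w ∈ B) :
    z ∈ away B w hw :=
  ⟨1, by simpa using h⟩

/-- Powers of comaximal elements are comaximal, so a partition of unity recovers `z` from `z * v ^
m` and `z * w ^ n`. -/
theorem mem_of_mem_away {B : Subalgebra k F} {v w : F} {hv : v ∈ B} {hw : w ∈ B} {r s : F}
    (hr : r ∈ B) (hs : s ∈ B) (hrs : r * v + s * w = 1) {z : F} (h1 : z ∈ away B v hv)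
    (h2 : z ∈ away B w hw) : z ∈ B := by
  obtain ⟨m, hm⟩ := h1
  obtain ⟨n, hn⟩ := h2
  have hc : IsCoprime (⟨v, hv⟩ : B) ⟨w, hw⟩ := ⟨⟨r, hr⟩, ⟨s, hs⟩, Subtype.ext hrs⟩
  obtain ⟨⟨r', hr'⟩, ⟨s', hs'⟩, h⟩ := hc.pow (m := m) (n := n)
  have h' : r' * v ^ m + s' * w ^ n = 1 := congrArg Subtype.val h
  have : z = r' * (z * v ^ m) + s' * (z * w ^ n) := by
    linear_combination (-z) * h'
  rw [this]
  exact B.add_mem (B.mul_mem hr' hm) (B.mul_mem hs' hn)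

/-- After mutating at `x`, at `y` and again at `x`, the new variables are Laurent polynomials in
`x, y, z`, and the first one is comaximal to the product of the other two. -/
theorem exists_comaximal (B : Subalgebra k F) {x y z x' y' x'' : F} (hx0 : x ≠ 0) (hy0 : y ≠ 0)
    (hz0 : z ≠ 0) (hx'0 : x' ≠ 0) (hx : x ∈ B) (hy : y ∈ B) (hz : z ∈ B) (hxi : x⁻¹ ∈ B)
    (hyi : y⁻¹ ∈ B) (hzi : z⁻¹ ∈ B) {b d e g : ℕ} (hb : 2 ≤ b) (hg : b * e = g + d)
    (h1 : x' = (y ^ b + z ^ d) / x) (h2 : y' = (x' ^ b + z ^ e) / y)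
    (h3 : x'' = (y' ^ b + z ^ g) / x') :
    x' ∈ B ∧ y' ∈ B ∧ x'' ∈ B ∧ ∃ r ∈ B, ∃ s ∈ B, r * x' + s * (y' * x'') = 1 := by
  have hx' : x' ∈ B := by
    rw [h1, div_eq_mul_inv]
    exact B.mul_mem (B.add_mem (B.pow_mem hy _) (B.pow_mem hz _)) hxi
  obtain ⟨b, rfl⟩ := Nat.exists_eq_add_of_le' hb
  have hy' : y' = z ^ e * y⁻¹ + x' * (x' ^ (b + 1) * y⁻¹) := by
    rw [h2]; field_simp; ring
  have hy'B : y' ∈ B := by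
    rw [h2, div_eq_mul_inv]
    exact B.mul_mem (B.add_mem (B.pow_mem hx' _) (B.pow_mem hz _)) hyi
  -- Modulo `x'` both `y'` and `x''` are Laurent monomials, hence units. For `x''`, use `(y * y') ^
  -- b ≡ z ^ (b * e)` modulo `x' ^ b` and `z ^ (b * e) + z ^ g * y ^ b = z ^ g * x * x'`; a factor
  -- `x'` survives the division by `x'` because `b ≥ 2`.
  obtain ⟨⟨T, hT⟩, hTe⟩ := (Commute.all (⟨x' ^ (b + 2) + z ^ e,
    B.add_mem (B.pow_mem hx' _) (B.pow_mem hz _)⟩ : B)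
    ⟨z ^ e, B.pow_mem hz _⟩).sub_dvd_pow_sub_pow (b + 2)
  have hTe' : (x' ^ (b + 2) + z ^ e) ^ (b + 2) - (z ^ e) ^ (b + 2) =
      (x' ^ (b + 2) + z ^ e - z ^ e) * T := congrArg Subtype.val hTe
  have hx'' : x'' = z ^ g * x * y⁻¹ ^ (b + 2) + x' * (x' ^ b * T * y⁻¹ ^ (b + 2)) := by
    have e1 : y' ^ (b + 2) = (x' ^ (b + 2) + z ^ e) ^ (b + 2) * y⁻¹ ^ (b + 2) := by
      rw [h2, div_eq_mul_inv, mul_pow]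
    have e2 : (z ^ e) ^ (b + 2) = z ^ g * z ^ d := by
      rw [← pow_mul, mul_comm e, hg, pow_add]
    have e3 : x * x' = y ^ (b + 2) + z ^ d := by rw [h1]; field_simp
    have e4 : y ^ (b + 2) * y⁻¹ ^ (b + 2) = 1 := by
      rw [← mul_pow, mul_inv_cancel₀ hy0, one_pow]
    rw [h3, div_eq_iff hx'0, e1]
    rw [e2] at hTe'
    generalize y⁻¹ ^ (b + 2) = Y at *
    linear_combination Y * hTe' - z ^ g * Y * e3 - z ^ g * e4
  have hyiB := B.pow_mem hyi (b + 2)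
  have hx''B : x'' ∈ B := by
    rw [hx'']
    exact B.add_mem (B.mul_mem (B.mul_mem (B.pow_mem hz _) hx) hyiB)
      (B.mul_mem hx' (B.mul_mem (B.mul_mem (B.pow_mem hx' _) hT) hyiB))
  refine ⟨hx', hy'B, hx''B, ?_⟩
  set u := z ^ e * y⁻¹ with hu
  set u' := z ^ g * x * y⁻¹ ^ (b + 2) with hu'
  set w := x' ^ (b + 1) * y⁻¹ with hw
  set w' := x' ^ b * T * y⁻¹ ^ (b + 2) with hw'
  have huB : u ∈ B := B.mul_mem (B.pow_mem hz _) hyi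
  have hu'B : u' ∈ B := B.mul_mem (B.mul_mem (B.pow_mem hz _) hx) hyiB
  have hwB : w ∈ B := B.mul_mem (B.pow_mem hx' _) hyi
  have hw'B : w' ∈ B := B.mul_mem (B.mul_mem (B.pow_mem hx' _) hT) hyiB
  have hUB : z⁻¹ ^ e * y * (z⁻¹ ^ g * x⁻¹ * y ^ (b + 2)) ∈ B :=
    B.mul_mem (B.mul_mem (B.pow_mem hzi _) hy)
      (B.mul_mem (B.mul_mem (B.pow_mem hzi _) hxi) (B.pow_mem hy _))
  have hU : z⁻¹ ^ e * y * (z⁻¹ ^ g * x⁻¹ * y ^ (b + 2)) * (u * u') = 1 := by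
    rw [hu, hu']
    simp only [inv_pow]
    field_simp
  generalize z⁻¹ ^ e * y * (z⁻¹ ^ g * x⁻¹ * y ^ (b + 2)) = U at *
  -- With `y' = u + x' * w`, `x'' = u' + x' * w'` and `U` inverse to `u * u'`, expand `U * (y' *
  -- x'')`.
  refine ⟨-U * (u * w' + w * u' + x' * w * w'), ?_, U, hUB, ?_⟩
  · exact B.mul_mem (B.neg_mem hUB) (B.add_mem (B.add_mem (B.mul_mem huB hw'B)
      (B.mul_mem hwB hu'B)) (B.mul_mem (B.mul_mem hx' hwB) hw'B))
  · rw [hy', hx'']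
    linear_combination hU

end LaurentPhenomenon

/-! ### Mutation of cyclic triangles and the Laurent phenomenon -/

namespace LaurentPhenomenon

variable {k F : Type*} [Field k] [Field F] [Algebra k F]

open ClusterAlgebra

/-- Mutation of a cyclic triangle: a cluster together with the multiplicities of the arrows, where
the `i`-th multiplicity counts the arrows between the two vertices other than `i`. -/
def mutateTriple (D : (Fin 3 → F) × (Fin 3 → ℕ)) (v : Fin 3) : (Fin 3 → F) × (Fin 3 → ℕ) :=
  (Function.update D.1 v ((D.1 (v + 1) ^ D.2 (v + 2) + D.1 (v + 2) ^ D.2 (v + 1)) / D.1 v),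
    Function.update D.2 v (D.2 (v + 1) * D.2 (v + 2) - D.2 v))

/-- A class of multiplicities of cyclic triangles that is stable under mutation. -/
def IsWild (m : Fin 3 → ℕ) : Prop :=
  (∀ i, 3 ≤ m i) ∧ m 0 ^ 2 + m 1 ^ 2 + m 2 ^ 2 ≤ m 0 * m 1 * m 2

/-- Vieta jumping: `b² + c² + d² - b c d` is invariant under `d ↦ d' = b c - d`. The bound on `d'`
follows from `d d' ≥ b² + c² ≥ 2 b c = 2 (d + d')`, that is, `(d - 2)(d' - 2) ≥ 4`. -/
theorem three_le_mul_sub {b c d : ℕ} (hb : 3 ≤ b) (hc : 3 ≤ c) (hd : 3 ≤ d)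
    (h : b ^ 2 + c ^ 2 + d ^ 2 ≤ b * c * d) :
    d ≤ b * c ∧ 3 ≤ b * c - d ∧ b ^ 2 + c ^ 2 + (b * c - d) ^ 2 ≤ b * c * (b * c - d) := by
  have h1 : d ≤ b * c := by
    by_contra! hlt
    nlinarith
  obtain ⟨d', hd'⟩ := Nat.exists_eq_add_of_le h1
  rw [hd', Nat.add_sub_cancel_left]
  refine ⟨by omega, ?_, ?_⟩
  · by_contra! hlt
    zify at *
    nlinarith [sq_nonneg ((b : ℤ) - c)]
  · zify at *
    rw [hd'] at h
    nlinarith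

theorem IsWild.le_mul {m : Fin 3 → ℕ} (h : IsWild m) (v : Fin 3) :
    m v ≤ m (v + 1) * m (v + 2) := by
  obtain ⟨h3, h⟩ := h
  fin_cases v
  · exact (three_le_mul_sub (h3 1) (h3 2) (h3 0) (by linarith)).1
  · exact (three_le_mul_sub (h3 2) (h3 0) (h3 1) (by linarith)).1
  · exact (three_le_mul_sub (h3 0) (h3 1) (h3 2) (by linarith)).1

theorem IsWild.mutate {D : (Fin 3 → F) × (Fin 3 → ℕ)} (h : IsWild D.2) (v : Fin 3) :
    IsWild (mutateTriple D v).2 := by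
  obtain ⟨h3, h⟩ := h
  fin_cases v
  · have := three_le_mul_sub (h3 1) (h3 2) (h3 0) (by linarith)
    refine ⟨fun i => ?_, ?_⟩
    · fin_cases i
      exacts [this.2.1, h3 1, h3 2]
    · simp [mutateTriple]
      linarith
  · have := three_le_mul_sub (h3 2) (h3 0) (h3 1) (by linarith)
    refine ⟨fun i => ?_, ?_⟩
    · fin_cases i
      exacts [h3 0, this.2.1, h3 2]
    · simp [mutateTriple]
      linarith
  · have := three_le_mul_sub (h3 0) (h3 1) (h3 2) (by linarith)
    refine ⟨fun i => ?_, ?_⟩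
    · fin_cases i
      exacts [h3 0, h3 1, this.2.1]
    · simp [mutateTriple]
      linarith

theorem add_one_ne (v : Fin 3) : v + 1 ≠ v := by decide +revert
theorem add_two_ne (v : Fin 3) : v + 2 ≠ v := by decide +revert

/-- The triple `D` records the seed `S`, whose quiver is an oriented triangle. -/
structure Records (S : Seed k F (Fin 3)) (D : (Fin 3 → F) × (Fin 3 → ℕ)) : Prop where
  frozen : S.frozen = ∅
  x_eq : S.x = D.1
  arrows : (∀ i, S.quiver.arrows i (i + 1) = D.2 (i + 2) ∧ S.quiver.arrows (i + 1) i = 0) ∨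
    (∀ i, S.quiver.arrows (i + 1) i = D.2 (i + 2) ∧ S.quiver.arrows i (i + 1) = 0)

/-- The composites run against the arrows opposite `v`. By `IsWild.le_mul` they are at least as
numerous, so cancellation leaves a cyclic triangle of the opposite orientation, and the truncated
subtraction in `mutateTriple` is exact. -/
theorem Records.mutate {S : Seed k F (Fin 3)} {D : (Fin 3 → F) × (Fin 3 → ℕ)}
    (h : Records S D) (hD : IsWild D.2) (v : Fin 3) (hv : v ∉ S.frozen) :
    Records (S.mutate v hv) (mutateTriple D v) := by
  obtain ⟨hf, hx, ha⟩ := h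
  have hle := hD.le_mul v
  have hl := S.quiver.no_loop
  refine ⟨hf, ?_, ?_⟩
  · simp only [Seed.mutate, Seed.mutatedCluster, mutateTriple, hx, Seed.exchangeNumerator,
      div_eq_mul_inv]
    congr 2
    rcases ha with ha | ha
    all_goals
      have h0 := ha 0
      have h1 := ha 1
      have h2 := ha 2
      fin_cases v <;> simp_all [Fin.prod_univ_three] <;> first | done | ring
  · rcases ha with ha | ha
    · right
      have h0 := ha 0
      have h1 := ha 1
      have h2 := ha 2
      intro i
      fin_cases v <;> fin_cases i <;>
        simp_all [Seed.mutate, ClusterQuiver.mutate, ClusterQuiver.cancelTwoCycles,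
          ClusterQuiver.reverseAt, ClusterQuiver.addComposites, mutateTriple, mul_comm]
    · left
      have h0 := ha 0
      have h1 := ha 1
      have h2 := ha 2
      intro i
      fin_cases v <;> fin_cases i <;>
        simp_all [Seed.mutate, ClusterQuiver.mutate, ClusterQuiver.cancelTwoCycles,
          ClusterQuiver.reverseAt, ClusterQuiver.addComposites, mutateTriple, mul_comm]

variable (k) in
/-- Triples that record a seed over `k` and have multiplicities in the stable class. -/
def Admissible (D : (Fin 3 → F) × (Fin 3 → ℕ)) : Prop :=
  IsWild D.2 ∧ ∃ S : Seed k F (Fin 3), Records S D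

theorem Admissible.mutate {D : (Fin 3 → F) × (Fin 3 → ℕ)} (h : Admissible k D) (v : Fin 3) :
    Admissible k (mutateTriple D v) := by
  obtain ⟨h1, S, h2⟩ := h
  exact ⟨h1.mutate v, S.mutate v (by simp [h2.frozen]), h2.mutate h1 v _⟩

theorem Admissible.ne_zero {D : (Fin 3 → F) × (Fin 3 → ℕ)} (h : Admissible k D) (i : Fin 3) :
    D.1 i ≠ 0 := by
  obtain ⟨-, S, h⟩ := h
  rw [← h.x_eq]
  exact S.algebraicIndependent.ne_zero i

theorem Admissible.mutate_mutate {D : (Fin 3 → F) × (Fin 3 → ℕ)} (h : Admissible k D)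
    (v : Fin 3) : mutateTriple (mutateTriple D v) v = D := by
  have hv := h.ne_zero v
  have hv' := (h.mutate v).ne_zero v
  have h1 := add_one_ne v
  have h2 := add_two_ne v
  have hle := h.1.le_mul v
  simp only [mutateTriple, Function.update_self] at hv'
  ext i
  · by_cases hi : i = v
    · subst hi
      simp only [mutateTriple, Function.update_self, Function.update_of_ne h1,
        Function.update_of_ne h2]
      rw [div_ne_zero_iff] at hv'
      have := hv'.1
      field_simp
    · simp [mutateTriple, hi]
  · by_cases hi : i = v
    · subst hi
      simp only [mutateTriple, Function.update_self, Function.update_of_ne h1,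
        Function.update_of_ne h2]
      omega
    · simp [mutateTriple, hi]

/-- Mutation along a list of vertices. -/
def run (l : List (Fin 3)) (D : (Fin 3 → F) × (Fin 3 → ℕ)) : (Fin 3 → F) × (Fin 3 → ℕ) :=
  l.foldl mutateTriple D

theorem forall_fin_three {P : Fin 3 → Prop} (v : Fin 3) (h0 : P v) (h1 : P (v + 1))
    (h2 : P (v + 2)) (i : Fin 3) : P i := by
  fin_cases v <;> fin_cases i <;> assumption

/-- The two hypotheses put `z` in the localisations of `laurent k D.1` at `x'` and at `y' * x''`, in
the notation of `exists_comaximal`; these elements are comaximal. -/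
theorem exists_comaximal_of_mutate {D : (Fin 3 → F) × (Fin 3 → ℕ)} (h : Admissible k D)
    {v w : Fin 3} (hvw : w ≠ v) {z : F} (h1 : z ∈ laurent k (mutateTriple D v).1)
    (h2 : z ∈ laurent k (mutateTriple (mutateTriple (mutateTriple D v) w) v).1) :
    z ∈ laurent k D.1 := by
  obtain ⟨u, huv, huw, hall, hu⟩ : ∃ u, u ≠ v ∧ u ≠ w ∧ (∀ i, i = v ∨ i = w ∨ i = u) ∧
      ((v + 1 = w ∧ v + 2 = u ∧ w + 1 = u ∧ w + 2 = v) ∨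
        (v + 1 = u ∧ v + 2 = w ∧ w + 1 = v ∧ w + 2 = u)) := by
    clear h1 h2
    decide +revert
  set D1 := mutateTriple D v with hD1
  set D2 := mutateTriple D1 w with hD2
  set D3 := mutateTriple D2 v with hD3
  have a1 : Admissible k D1 := h.mutate v
  have a2 : Admissible k D2 := a1.mutate w
  have a3 : Admissible k D3 := a2.mutate v
  have e1 : D1.1 v = (D.1 w ^ D.2 u + D.1 u ^ D.2 w) / D.1 v := by
    rcases hu with ⟨q1, q2, q3, q4⟩ | ⟨q1, q2, q3, q4⟩ <;>
      simp [hD1, mutateTriple, q1, q2, add_comm]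
  have n1 : D1.2 v = D.2 w * D.2 u - D.2 v := by
    rcases hu with ⟨q1, q2, q3, q4⟩ | ⟨q1, q2, q3, q4⟩ <;>
      simp [hD1, mutateTriple, q1, q2, mul_comm]
  have f1 : ∀ i, i ≠ v → D1.1 i = D.1 i ∧ D1.2 i = D.2 i := fun i hi => by
    simp [hD1, mutateTriple, hi]
  have e2 : D2.1 w = (D1.1 v ^ D.2 u + D.1 u ^ D1.2 v) / D.1 w := by
    rcases hu with ⟨q1, q2, q3, q4⟩ | ⟨q1, q2, q3, q4⟩ <;>
      simp [hD2, mutateTriple, q3, q4, f1 _ huv, f1 _ hvw, add_comm]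
  have n2 : D2.2 w = D.2 u * D1.2 v - D.2 w := by
    rcases hu with ⟨q1, q2, q3, q4⟩ | ⟨q1, q2, q3, q4⟩ <;>
      simp [hD2, mutateTriple, q3, q4, f1 _ huv, f1 _ hvw, mul_comm]
  have f2 : ∀ i, i ≠ w → D2.1 i = D1.1 i ∧ D2.2 i = D1.2 i := fun i hi => by
    simp [hD2, mutateTriple, hi]
  have e3 : D3.1 v = (D2.1 w ^ D.2 u + D.1 u ^ D2.2 w) / D1.1 v := by
    rcases hu with ⟨q1, q2, q3, q4⟩ | ⟨q1, q2, q3, q4⟩ <;>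
      simp [hD3, mutateTriple, q1, q2, f2 _ huw, f1 _ huv, f2 _ hvw.symm, add_comm]
  have f3 : ∀ i, i ≠ v → D3.1 i = D2.1 i := fun i hi => by
    simp [hD3, mutateTriple, hi]
  have hg : D.2 u * D1.2 v = D2.2 w + D.2 w := by
    have h5 := a2.1.1 w
    rw [n2] at h5 ⊢
    omega
  obtain ⟨b1, b2, b3, r, hr, s, hs, hrs⟩ := exists_comaximal (laurent k D.1) (h.ne_zero v)
    (h.ne_zero w) (h.ne_zero u) (a1.ne_zero v) (mem_laurent _ v) (mem_laurent _ w)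
    (mem_laurent _ u) (inv_mem_laurent _ v) (inv_mem_laurent _ w) (inv_mem_laurent _ u)
    ((by norm_num : 2 ≤ 3).trans (h.1.1 u)) hg e1 e2 e3
  have c1 := a1.ne_zero v
  have c2 := a2.ne_zero w
  have c3 := a3.ne_zero v
  have B1 := le_away (laurent k D.1) _ b1
  have B2 := le_away (laurent k D.1) _ ((laurent k D.1).mul_mem b2 b3)
  refine mem_of_mem_away (hv := b1) (hw := (laurent k D.1).mul_mem b2 b3) hr hs hrs
    (laurent_le (fun i => ?_) (fun i => ?_) h1) (laurent_le (fun i => ?_) (fun i => ?_) h2)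
  · rcases hall i with rfl | rfl | rfl
    · exact B1 b1
    · rw [(f1 _ hvw).1]
      exact B1 (mem_laurent _ _)
    · rw [(f1 _ huv).1]
      exact B1 (mem_laurent _ _)
  · rcases hall i with rfl | rfl | rfl
    · refine mem_away ?_
      rw [inv_mul_cancel₀ c1]
      exact one_mem _
    · rw [(f1 _ hvw).1]
      exact B1 (inv_mem_laurent _ _)
    · rw [(f1 _ huv).1]
      exact B1 (inv_mem_laurent _ _)
  · rcases hall i with rfl | rfl | rfl
    · exact B2 b3
    · rw [f3 _ hvw]
      exact B2 b2
    · rw [f3 _ huv, (f2 _ huw).1, (f1 _ huv).1]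
      exact B2 (mem_laurent _ _)
  · rcases hall i with rfl | rfl | rfl
    · refine mem_away ?_
      rw [mul_comm, mul_assoc, mul_inv_cancel₀ c3, mul_one]
      exact b2
    · refine mem_away ?_
      rw [f3 _ hvw, inv_mul_cancel_left₀ c2]
      exact b3
    · rw [f3 _ huv, (f2 _ huw).1, (f1 _ huv).1]
      exact B2 (inv_mem_laurent _ _)

/-- The Laurent phenomenon. -/
theorem run_mem_laurent (n : ℕ) : ∀ {D : (Fin 3 → F) × (Fin 3 → ℕ)}, Admissible k D →
    ∀ l : List (Fin 3), l.length = n → ∀ i, (run l D).1 i ∈ laurent k D.1 := by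
  induction n using Nat.strong_induction_on with
  | _ n ih =>
  intro D hD l hl i
  match l, hl with
  | [], _ => exact mem_laurent _ i
  | [v], _ =>
    change (mutateTriple D v).1 i ∈ _
    by_cases hi : i = v
    · subst hi
      simp only [mutateTriple, Function.update_self, div_eq_mul_inv]
      exact mul_mem (add_mem (pow_mem (mem_laurent _ _) _) (pow_mem (mem_laurent _ _) _))
        (inv_mem_laurent _ _)
    · simp only [mutateTriple, Function.update_of_ne hi]
      exact mem_laurent _ _
  | v :: w :: l, hl =>
    simp only [List.length_cons] at hl
    by_cases hvw : w = v
    · subst hvw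
      have : run (w :: w :: l) D = run l D := by
        change run l (mutateTriple (mutateTriple D w) w) = _
        rw [hD.mutate_mutate]
      rw [this]
      exact ih l.length (by omega) hD l rfl i
    -- Undoing the last of the mutations `v, w, v` reaches the same seed from there by `v :: l`,
    -- which is one step shorter than `v :: w :: l`.
    · refine exists_comaximal_of_mutate hD hvw (ih (l.length + 1) (by omega) (hD.mutate v)
        (w :: l) rfl i) ?_
      have h := ih (l.length + 1) (by omega) (((hD.mutate v).mutate w).mutate v) (v :: l) rfl i
      have h' : run (v :: l) (mutateTriple (mutateTriple (mutateTriple D v) w) v) =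
          run (v :: w :: l) D := by
        change run l (mutateTriple (mutateTriple _ v) v) = _
        rw [((hD.mutate v).mutate w).mutate_mutate]
        rfl
      rwa [h'] at h

theorem exists_run_of_mutationEquivalent {S T : Seed k F (Fin 3)}
    {D : (Fin 3 → F) × (Fin 3 → ℕ)} (hD : IsWild D.2) (h : Records S D)
    (hT : S.MutationEquivalent T) :
    ∃ l, IsWild (run l D).2 ∧ Records T (run l D) := by
  induction hT with
  | refl => exact ⟨[], hD, h⟩
  | tail _ hbc ih =>
    obtain ⟨v, hv, rfl⟩ := hbc
    obtain ⟨l, hl, hr⟩ := ih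
    refine ⟨l ++ [v], ?_⟩
    have : run (l ++ [v]) D = mutateTriple (run l D) v := by simp [run]
    rw [this]
    exact ⟨hl.mutate v, hr.mutate hl v hv⟩

theorem clusterAlgebra_le_laurent {S : Seed k F (Fin 3)} {D : (Fin 3 → F) × (Fin 3 → ℕ)}
    (hD : IsWild D.2) (h : Records S D) : S.clusterAlgebra ≤ laurent k D.1 := by
  refine Algebra.adjoin_le ?_
  rintro _ (⟨T, hT, i, rfl⟩ | ⟨i, hi, rfl⟩)
  · obtain ⟨l, -, hl⟩ := exists_run_of_mutationEquivalent hD h hT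
    rw [hl.x_eq]
    exact run_mem_laurent _ ⟨hD, S, h⟩ l rfl i
  · simp [h.frozen] at hi

/-- Mutation is an involution, so prefixing `v` to a path from `D` gives a path from its neighbour
to the same seed. -/
theorem clusterAlgebra_le_laurent_mutate {S : Seed k F (Fin 3)}
    {D : (Fin 3 → F) × (Fin 3 → ℕ)} (hD : IsWild D.2) (h : Records S D) (v : Fin 3) :
    S.clusterAlgebra ≤ laurent k (mutateTriple D v).1 := by
  refine Algebra.adjoin_le ?_
  rintro _ (⟨T, hT, i, rfl⟩ | ⟨i, hi, rfl⟩)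
  · obtain ⟨l, -, hl⟩ := exists_run_of_mutationEquivalent hD h hT
    have hA : Admissible k D := ⟨hD, S, h⟩
    have : run l D = run (v :: l) (mutateTriple D v) := by
      change _ = run l (mutateTriple (mutateTriple D v) v)
      rw [hA.mutate_mutate]
    rw [hl.x_eq, this]
    exact run_mem_laurent _ (hA.mutate v) (v :: l) rfl i
  · simp [h.frozen] at hi

theorem mem_clusterAlgebra {S : Seed k F (Fin 3)} (i : Fin 3) : S.x i ∈ S.clusterAlgebra :=
  Algebra.subset_adjoin (Or.inl ⟨S, Relation.ReflTransGen.refl, i, rfl⟩)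

theorem mutate_mem_clusterAlgebra {S : Seed k F (Fin 3)} {D : (Fin 3 → F) × (Fin 3 → ℕ)}
    (hD : IsWild D.2) (h : Records S D) (v i : Fin 3) :
    (mutateTriple D v).1 i ∈ S.clusterAlgebra := by
  have hv : v ∉ S.frozen := by simp [h.frozen]
  rw [← (h.mutate hD v hv).x_eq]
  exact Algebra.subset_adjoin
    (Or.inl ⟨S.mutate v hv, Relation.ReflTransGen.single ⟨v, hv, rfl⟩, i, rfl⟩)

end LaurentPhenomenon

/-! ### Laurent monomials and their coefficients -/

namespace LaurentPhenomenon

/-- The Laurent monomial with exponent vector `α`. -/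
def mon {F ι : Type*} [Field F] [Fintype ι] (x : ι → F) (α : ι → ℤ) : F := ∏ i, x i ^ α i

section Monomials

variable {F ι : Type*} [Field F] [Fintype ι] {x : ι → F}

theorem mon_zero (x : ι → F) : mon x 0 = 1 := by simp [mon]

theorem mon_add (hx : ∀ i, x i ≠ 0) (α β : ι → ℤ) : mon x (α + β) = mon x α * mon x β := by
  simp [mon, zpow_add₀ (hx _), Finset.prod_mul_distrib]

theorem mon_nsmul (x : ι → F) (q : ℕ) (α : ι → ℤ) :
    mon x (q • α) = mon x α ^ q := by
  simp only [mon, ← Finset.prod_pow, Pi.smul_apply, nsmul_eq_mul]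
  refine Finset.prod_congr rfl fun i _ => ?_
  rw [mul_comm, zpow_mul, zpow_natCast]

theorem mon_single [DecidableEq ι] (x : ι → F) (i : ι) : mon x (Pi.single i 1) = x i := by
  rw [mon, Finset.prod_eq_single i] <;> simp +contextual

variable {k : Type*} [Field k] [Algebra k F]

theorem linearIndependent_mon (hx : AlgebraicIndependent k x) : LinearIndependent k (mon x) := by
  classical
  have hx0 : ∀ i, x i ≠ 0 := hx.ne_zero
  rw [linearIndependent_iff']
  intro s g hs α₀ hα₀
  -- A common shift that makes every exponent in `s` nonnegative, so that a relation among Laurent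
  -- monomials becomes one among ordinary monomials.
  set N : ι → ℤ := fun _ => ∑ α ∈ s, ∑ i, |α i| with hN
  have hpos : ∀ α ∈ s, ∀ i, 0 ≤ α i + N i := by
    intro α hα i
    have h1 : |α i| ≤ ∑ i, |α i| :=
      Finset.single_le_sum (f := fun i => |α i|) (fun j _ => abs_nonneg _) (Finset.mem_univ i)
    have h2 : ∑ i, |α i| ≤ ∑ α ∈ s, ∑ i, |α i| :=
      Finset.single_le_sum (f := fun α : ι → ℤ => ∑ i, |α i|)
        (fun β _ => Finset.sum_nonneg fun j _ => abs_nonneg _) hα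
    have h3 := neg_abs_le (α i)
    simp only [hN]
    linarith
  let e : (ι → ℤ) → (ι →₀ ℕ) := fun α =>
    Finsupp.equivFunOnFinite.symm fun i => (α i + N i).toNat
  have he : ∀ α ∈ s, ∀ i, ((e α i : ℕ) : ℤ) = α i + N i := fun α hα i =>
    Int.toNat_of_nonneg (hpos α hα i)
  have hinj : ∀ α ∈ s, e α = e α₀ → α = α₀ := by
    intro α hα h
    funext i
    have h1 := he α hα i
    have h2 := he α₀ hα₀ i
    rw [h] at h1
    linarith
  have haeval : MvPolynomial.aeval x (∑ α ∈ s, MvPolynomial.monomial (e α) (g α)) = 0 := by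
    have hterm : ∀ α ∈ s, MvPolynomial.aeval x (MvPolynomial.monomial (e α) (g α)) =
        g α • mon x α * mon x N := by
      intro α hα
      rw [MvPolynomial.aeval_monomial, Algebra.smul_def, mul_assoc, ← mon_add hx0,
        Finsupp.prod_fintype _ _ (by simp)]
      congr 1
      refine Finset.prod_congr rfl fun i _ => ?_
      rw [← zpow_natCast, he α hα]
      rfl
    rw [map_sum, Finset.sum_congr rfl hterm, ← Finset.sum_mul, hs, zero_mul]
  have h0 := hx (haeval.trans (map_zero _).symm)
  have h1 := congrArg (MvPolynomial.coeff (e α₀)) h0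
  rw [MvPolynomial.coeff_sum, Finset.sum_eq_single α₀] at h1
  · simpa using h1
  · intro α hα hne
    rw [MvPolynomial.coeff_monomial, if_neg fun h => hne (hinj α hα h)]
  · exact fun h => absurd hα₀ h

theorem laurent_le_span_mon (hx : ∀ i, x i ≠ 0) :
    Subalgebra.toSubmodule (laurent k x) ≤ Submodule.span k (Set.range (mon x)) := by
  classical
  rw [laurent, Algebra.adjoin_eq_span]
  refine Submodule.span_mono ?_
  let M : Submonoid F :=
    { carrier := Set.range (mon x)
      one_mem' := ⟨0, mon_zero x⟩
      mul_mem' := by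
        rintro _ _ ⟨α, rfl⟩ ⟨β, rfl⟩
        exact ⟨α + β, mon_add hx α β⟩ }
  change Submonoid.closure _ ≤ M
  rw [Submonoid.closure_le]
  rintro _ (⟨i, rfl⟩ | ⟨i, rfl⟩)
  · exact ⟨Pi.single i 1, mon_single x i⟩
  · refine ⟨-Pi.single i 1, ?_⟩
    have h := mon_add hx (-Pi.single i 1) (Pi.single i 1)
    rw [neg_add_cancel, mon_zero, mon_single] at h
    exact eq_inv_of_mul_eq_one_left h.symm

theorem mon_mem_laurent (x : ι → F) (α : ι → ℤ) : mon x α ∈ laurent k x := by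
  refine prod_mem fun i _ => ?_
  obtain ⟨n, hn | hn⟩ := (α i).eq_nat_or_neg
  · rw [hn, zpow_natCast]
    exact pow_mem (mem_laurent x i) n
  · rw [hn, zpow_neg, zpow_natCast, ← inv_pow]
    exact pow_mem (inv_mem_laurent x i) n

/-- The value at `β` is the coefficient of `w` at `-β`. -/
theorem finite_coeff (hx : ∀ i, x i ≠ 0) (c : F →ₗ[k] k) (hc : ∀ α ≠ 0, c (mon x α) = 0) {w : F}
    (hw : w ∈ laurent k x) : {β | c (mon x β * w) ≠ 0}.Finite := by
  have hw' := laurent_le_span_mon hx hw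
  clear hw
  induction hw' using Submodule.span_induction with
  | mem w h =>
    obtain ⟨α, rfl⟩ := h
    refine (Set.finite_singleton (-α)).subset fun β hβ => ?_
    by_contra hne
    refine hβ ?_
    rw [← mon_add hx]
    exact hc _ fun h => hne (eq_neg_of_add_eq_zero_left h)
  | zero => simp
  | add y z _ _ hy hz =>
    refine (hy.union hz).subset fun β hβ => ?_
    by_contra hne
    simp only [Set.mem_union, Set.mem_ofPred_eq, not_or, not_not] at hne
    refine hβ ?_
    rw [mul_add, map_add, hne.1, hne.2, add_zero]
  | smul r y _ hy =>
    refine hy.subset fun β hβ => ?_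
    intro h0
    refine hβ ?_
    rw [mul_smul_comm, map_smul, h0, smul_zero]

/-- Write `α = ρ + q • β` with `ρ` in the box `[0, q)`. Then `Ψ (x^α) = x^β Ψ (x^ρ)`, and
`finite_coeff` treats each of the finitely many `ρ`. -/
theorem finite_support (hx : ∀ i, x i ≠ 0) (c : F →ₗ[k] k) (hc : ∀ α ≠ 0, c (mon x α) = 0)
    {q : ℕ} (hq : 0 < q) (Ψ : F →+ F) (hΨ : ∀ r z, Ψ (r ^ q * z) = r * Ψ z)
    (hL : ∀ z ∈ laurent k x, Ψ z ∈ laurent k x) : {α | c (Ψ (mon x α)) ≠ 0}.Finite := by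
  have hbox : (Set.univ.pi fun _ : ι => Set.Ico (0 : ℤ) q).Finite :=
    Set.Finite.pi fun _ => Set.finite_Ico _ _
  refine (hbox.biUnion fun ρ _ => (finite_coeff hx c hc (hL _ (mon_mem_laurent x ρ))).image
    fun β => ρ + q • β).subset fun α hα => ?_
  have hq' : (0 : ℤ) < q := by exact_mod_cast hq
  have hα' : (fun i => α i % q) + q • (fun i => α i / (q : ℤ)) = α := by
    funext i
    simp [Int.emod_add_mul_ediv]
  simp only [Set.mem_iUnion]
  refine ⟨fun i => α i % q, fun i _ => ⟨Int.emod_nonneg _ hq'.ne', Int.emod_lt_of_pos _ hq'⟩,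
    fun i => α i / q, ?_, hα'⟩
  rw [Set.mem_ofPred_eq, ← hΨ, ← mon_nsmul, ← mon_add hx, add_comm, hα']
  exact hα

end Monomials

/-! ### Constant term functionals shared by adjacent clusters -/

theorem exists_dual {K V ι : Type*} [Field K] [AddCommGroup V] [Module K V] {v : ι → V}
    (hv : LinearIndependent K v) (i₀ : ι) :
    ∃ f : V →ₗ[K] K, f (v i₀) = 1 ∧ ∀ i ≠ i₀, f (v i) = 0 := by
  obtain ⟨f, hf⟩ := (Finsupp.lapply i₀ ∘ₗ hv.repr).exists_extend
  have h : ∀ i, f (v i) = Finsupp.single i (1 : K) i₀ := fun i => by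
    have := LinearMap.congr_fun hf ⟨v i, Submodule.subset_span ⟨i, rfl⟩⟩
    simpa [hv.repr_eq_single i ⟨v i, Submodule.subset_span ⟨i, rfl⟩⟩ rfl] using this
  refine ⟨f, by simp [h], fun i hi => by simp [h, hi]⟩

theorem linearIndependent_zpow {K F : Type*} [Field K] [Field F] [Algebra K F] {x : F}
    (hx : Transcendental K x) : LinearIndependent K fun n : ℤ => x ^ n := by
  have h := linearIndependent_mon (algebraicIndependent_iff_transcendental.mpr hx)
  have h' := h.comp (fun n : ℤ => fun _ : Fin 1 => n) fun m n hmn => congrFun hmn 0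
  convert h' using 1
  funext n
  simp [mon]

/-- A functional on `F` that factors through the constant term with respect to `x`. -/
theorem exists_extend_constantTerm {k F : Type*} [Field k] [Field F] [Algebra k F]
    (K : IntermediateField k F) {x : F} (hx : Transcendental K x) (c₀ : F →ₗ[k] k) :
    ∃ c : F →ₗ[k] k, (∀ u ∈ K, c u = c₀ u) ∧ ∀ u ∈ K, ∀ n : ℤ, n ≠ 0 → c (u * x ^ n) = 0 := by
  have hli := linearIndependent_zpow hx
  obtain ⟨c₁, h1, h1'⟩ := exists_dual hli 0
  rw [zpow_zero] at h1
  refine ⟨c₀ ∘ₗ K.val.toLinearMap ∘ₗ c₁.restrictScalars k, fun u hu => ?_,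
    fun u hu n hn => ?_⟩
  · have h2 : c₁ u = ⟨u, hu⟩ := by
      have := c₁.map_smul (⟨u, hu⟩ : K) 1
      rwa [h1, Algebra.smul_def, mul_one, smul_eq_mul, mul_one,
        IntermediateField.algebraMap_apply] at this
    simp [h2]
  · have h2 : c₁ (u * x ^ n) = 0 := by
      have := c₁.map_smul (⟨u, hu⟩ : K) (x ^ n)
      rwa [h1' n hn, smul_zero, Algebra.smul_def, IntermediateField.algebraMap_apply] at this
    simp [h2]

/-- The exponent vector with prescribed values, listed from the index `v` on. -/
def tri (v : Fin 3) (a b c : ℤ) : Fin 3 → ℤ :=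
  fun i => if i = v then a else if i = v + 1 then b else c

theorem tri_self (v : Fin 3) (a b c : ℤ) : tri v a b c v = a := by simp [tri]
theorem tri_one (v : Fin 3) (a b c : ℤ) : tri v a b c (v + 1) = b := by simp [tri]
theorem tri_two (v : Fin 3) (a b c : ℤ) : tri v a b c (v + 2) = c := by
  simp [tri]

theorem tri_eta (v : Fin 3) (α : Fin 3 → ℤ) : tri v (α v) (α (v + 1)) (α (v + 2)) = α := by
  funext i
  exact forall_fin_three (P := fun i => tri v (α v) (α (v + 1)) (α (v + 2)) i = α i) v
    (tri_self ..) (tri_one ..) (tri_two ..) i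

theorem sum_tri (v : Fin 3) (a b c : ℤ) : ∑ i, tri v a b c i = a + b + c := by
  fin_cases v <;> simp [tri, Fin.sum_univ_three] <;> ring

theorem mon_tri {F : Type*} [Field F] (x : Fin 3 → F) (v : Fin 3) (a b c : ℤ) :
    mon x (tri v a b c) = x v ^ a * (x (v + 1) ^ b * x (v + 2) ^ c) := by
  fin_cases v <;> simp [tri, mon, Fin.prod_univ_three] <;> ring

/-- The cluster obtained from `x` by exchanging `x v`, for `a` arrows between any two vertices. -/
def exchange {F : Type*} [Field F] (a : ℕ) (x : Fin 3 → F) (v : Fin 3) : Fin 3 → F :=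
  Function.update x v ((x (v + 1) ^ a + x (v + 2) ^ a) / x v)

section Exchange

variable {F : Type*} [Field F] (a : ℕ) (x : Fin 3 → F) (v : Fin 3)

theorem exchange_self : exchange a x v v = (x (v + 1) ^ a + x (v + 2) ^ a) / x v := by
  simp [exchange]

theorem exchange_one : exchange a x v (v + 1) = x (v + 1) := by
  simp [exchange]

theorem exchange_two : exchange a x v (v + 2) = x (v + 2) := by
  simp [exchange]

/-- A total constant term functional, for the Laurent polynomials in `x` and for those in the
cluster exchanged at `v`. -/
theorem exists_constantTerm {k : Type*} [Field k] [Algebra k F] (hx : AlgebraicIndependent k x) :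
    ∃ c : F →ₗ[k] k, c 1 = 1 ∧ (∀ α ≠ 0, c (mon x α) = 0) ∧
      ∀ α ≠ 0, c (mon (exchange a x v) α) = 0 := by
  obtain ⟨K, hK⟩ : ∃ K, K = IntermediateField.adjoin k (x '' {v}ᶜ) := ⟨_, rfl⟩
  have htr : Transcendental K (x v) := by
    rw [hK]
    exact IntermediateField.transcendental_adjoin_iff.mpr
      (hx.transcendental_adjoin (s := {v}ᶜ) (i := v) (by simp))
  have hli := linearIndependent_mon hx
  obtain ⟨c₀, h0, h0'⟩ := exists_dual hli 0
  rw [mon_zero] at h0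
  have hy : x (v + 1) ∈ K := by
    rw [hK]
    exact IntermediateField.subset_adjoin _ _ (Set.mem_image_of_mem x (by simp))
  have hz : x (v + 2) ∈ K := by
    rw [hK]
    exact IntermediateField.subset_adjoin _ _ (Set.mem_image_of_mem x (by simp))
  obtain ⟨c, key', key⟩ := exists_extend_constantTerm K htr c₀
  have hu : ∀ m n : ℤ, x (v + 1) ^ m * x (v + 2) ^ n ∈ K := fun m n =>
    mul_mem (zpow_mem hy m) (zpow_mem hz n)
  have hP : x (v + 1) ^ a + x (v + 2) ^ a ∈ K := add_mem (pow_mem hy a) (pow_mem hz a)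
  refine ⟨c, (key' 1 K.one_mem).trans h0, fun α hα => ?_, fun α hα => ?_⟩
  · by_cases hv : α v = 0
    · have h := h0' α hα
      rw [← tri_eta v α, mon_tri, hv, zpow_zero, one_mul] at h ⊢
      rw [key' _ (hu _ _), h]
    · rw [← tri_eta v α, mon_tri, mul_comm]
      exact key _ (hu _ _) _ hv
  · by_cases hv : α v = 0
    · have h := h0' α hα
      rw [← tri_eta v α, mon_tri, hv, zpow_zero, one_mul] at h ⊢
      rw [exchange_one, exchange_two, key' _ (hu _ _), h]
    -- The `n`-th power of the exchanged variable is `P ^ n * x v ^ (-n)` with `P ∈ K`, so for `n ≠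
    -- 0` it dies with the nonzero powers of `x v`.
    · rw [← tri_eta v α, mon_tri, exchange_self, exchange_one, exchange_two, div_eq_mul_inv,
        mul_zpow, inv_zpow', mul_right_comm]
      exact key _ (mul_mem (zpow_mem hP _) (hu _ _)) _ (neg_ne_zero.mpr hv)

end Exchange

/-! ### The support argument -/

/-- A nonzero finitely supported function that is divisible by `(1 + T ^ a) ^ m` has a support of
width at least `a * m`. -/
theorem exists_wide_support {k : Type*} [AddCommGroup k] {a m : ℕ} {g g' : ℤ → k}
    (hfin : {t | g' t ≠ 0}.Finite) (ha : 0 < a)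
    (hg : ∀ t, g t = ∑ l ∈ Finset.range (m + 1), m.choose l • g' (t + a * l)) (h0 : ∃ t, g t ≠ 0) :
    ∃ t₁ t₂, g t₁ ≠ 0 ∧ g t₂ ≠ 0 ∧ t₁ + a * m ≤ t₂ := by
  have hne : {t | g' t ≠ 0}.Nonempty := by
    by_contra! h
    obtain ⟨t, ht⟩ := h0
    refine ht ?_
    rw [hg]
    refine Finset.sum_eq_zero fun l _ => ?_
    have : g' (t + a * l) = 0 := by
      by_contra h'
      have : t + a * l ∈ {t | g' t ≠ 0} := h'
      rw [h] at this
      exact this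
    rw [this, smul_zero]
  have ha' : (0 : ℤ) < a := by exact_mod_cast ha
  obtain ⟨M, hM, hMle⟩ := hfin.exists_maximal hne
  obtain ⟨N, hN, hNle⟩ := hfin.exists_minimal hne
  have hMle : ∀ t, M < t → g' t = 0 := fun t ht => by
    by_contra h
    exact absurd (hMle h ht.le) (not_le.mpr ht)
  have hNle : ∀ t, t < N → g' t = 0 := fun t ht => by
    by_contra h
    exact absurd (hNle h ht.le) (not_le.mpr ht)
  -- At these two places only one extreme term survives. Its binomial coefficient is 1, so the
  -- characteristic is harmless.
  refine ⟨N - a * m, M, ?_, ?_, ?_⟩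
  · rw [hg, Finset.sum_eq_single m]
    · simpa using hN
    · intro l hl hlm
      have : l < m := by
        have := Finset.mem_range.mp hl
        omega
      rw [hNle, smul_zero]
      have : (l : ℤ) < m := by exact_mod_cast this
      nlinarith
    · simp
  · rw [hg, Finset.sum_eq_single 0]
    · simpa using hM
    · intro l _ hl
      rw [hMle, smul_zero]
      have : (0 : ℤ) < l := by exact_mod_cast Nat.pos_of_ne_zero hl
      nlinarith
    · simp
  · by_contra! h
    exact hN (hMle N (by linarith))

/-- A Frobenius-inverse linear map that preserves the Laurent polynomials in a cluster and in the
three clusters adjacent to it does not take a cluster variable to `1`. -/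
theorem ne_one_of_preserves_laurent {k F : Type*} [Field k] [Field F] [Algebra k F] {a : ℕ}
    (ha : 3 ≤ a) {x : Fin 3 → F} (hx : AlgebraicIndependent k x)
    (hP : ∀ v, exchange a x v v ≠ 0) {q : ℕ} (hq : 0 < q) (Ψ : F →+ F)
    (hΨ : ∀ r z, Ψ (r ^ q * z) = r * Ψ z) (hL : ∀ z ∈ laurent k x, Ψ z ∈ laurent k x)
    (hL' : ∀ v, ∀ z ∈ laurent k (exchange a x v), Ψ z ∈ laurent k (exchange a x v)) (i : Fin 3) :
    Ψ (x i) ≠ 1 := by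
  intro h1
  have hx0 : ∀ i, x i ≠ 0 := hx.ne_zero
  have hy0 : ∀ v i, exchange a x v i ≠ 0 := fun v =>
    forall_fin_three v (hP v) (by rw [exchange_one]; exact hx0 _)
      (by rw [exchange_two]; exact hx0 _)
  choose c hc1 hc hc' using fun v => exists_constantTerm a x v hx
  -- The functional depends on `v`, but its restriction to `laurent k x` does not, so `σ` can be
  -- read with any of them.
  have hcc : ∀ v, ∀ z ∈ laurent k x, c v z = c 0 z := by
    intro v z hz
    have : Set.EqOn (c v) (c 0) (Submodule.span k (Set.range (mon x))) := by
      refine LinearMap.eqOn_span' ?_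
      rintro _ ⟨α, rfl⟩
      by_cases hα : α = 0
      · rw [hα, mon_zero, hc1, hc1]
      · rw [hc _ _ hα, hc _ _ hα]
    exact this (laurent_le_span_mon hx0 hz)
  let σ : (Fin 3 → ℤ) → k := fun α => c 0 (Ψ (mon x α))
  have hσfin : {α | σ α ≠ 0}.Finite := finite_support hx0 (c 0) (hc 0) hq Ψ hΨ hL
  let S := {α | σ α ≠ 0 ∧ ∑ i, α i = 1}
  have hS : S.Finite := hσfin.subset fun α h => h.1
  have hSne : Pi.single i 1 ∈ S := by
    refine ⟨?_, by simp⟩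
    simp only [σ, mon_single, h1, hc1]
    exact one_ne_zero
  obtain ⟨⟨α, v⟩, ⟨hαS, -⟩, hmax⟩ := (hS.prod (Set.finite_univ (α := Fin 3))).exists_maximalFor
    (fun r => r.1 r.2) _ ⟨(Pi.single i 1, i), hSne, trivial⟩
  have hmax : ∀ β ∈ S, ∀ j, β j ≤ α v := by
    intro β hβ j
    by_contra! hlt
    exact absurd (hmax (j := (β, j)) ⟨hβ, trivial⟩ hlt.le) (not_le.mpr hlt)
  have hpos : 1 ≤ α v := by simpa using hmax _ hSne i
  obtain ⟨m, hm⟩ := Int.eq_ofNat_of_zero_le (zero_le_one.trans hpos)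
  set b := α (v + 1) with hb
  set d := α (v + 2) with hd
  have hα : tri v m b d = α := by rw [← hm, hb, hd, tri_eta]
  have hsum : m + b + d = 1 := by rw [← hαS.2, ← hα, sum_tri]
  let σ' : (Fin 3 → ℤ) → k := fun γ => c v (Ψ (mon (exchange a x v) γ))
  have hσ'fin : {γ | σ' γ ≠ 0}.Finite := finite_support (hy0 v) (c v) (hc' v) hq Ψ hΨ (hL' v)
  -- The line through `α` in the plane of degree 1 with `v`-coordinate fixed at `m`. The shift `a *
  -- m` in `g'` is the degree of `(y^a + z^a)^m`.
  let g : ℤ → k := fun t => σ (tri v m (b + t) (d - t))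
  let g' : ℤ → k := fun t => σ' (tri v (-m) (b + t) (d - t + a * m))
  have hg'fin : {t | g' t ≠ 0}.Finite := by
    refine hσ'fin.preimage (f := fun t => tri v (-m) (b + t) (d - t + a * m)) ?_
    intro s _ t _ hst
    have := congrFun hst (v + 1)
    simp only [tri_one] at this
    linarith
  have hmon : ∀ t, mon x (tri v m (b + t) (d - t)) = ∑ l ∈ Finset.range (m + 1),
      m.choose l • mon (exchange a x v) (tri v (-m) (b + (t + a * l)) (d - (t + a * l) + a * m)) := by
    intro t
    have hPv := hP v
    rw [exchange_self, div_ne_zero_iff] at hPv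
    simp only [mon_tri, exchange_self, exchange_one, exchange_two]
    set P := x (v + 1) ^ a + x (v + 2) ^ a with hPdef
    have hPm : P ^ m = ∑ l ∈ Finset.range (m + 1),
        x (v + 1) ^ ((a : ℤ) * l) * x (v + 2) ^ ((a : ℤ) * m - a * l) * m.choose l := by
      rw [hPdef, add_pow]
      refine Finset.sum_congr rfl fun l hl => ?_
      have hl' : l ≤ m := Nat.lt_succ_iff.mp (Finset.mem_range.mp hl)
      rw [← pow_mul, ← pow_mul, ← zpow_natCast, ← zpow_natCast (x (v + 2))]
      push_cast [hl']
      rw [mul_sub]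
    have hxm : x v ^ (m : ℤ) = P ^ m * (P / x v) ^ (-(m : ℤ)) := by
      rw [zpow_neg, zpow_natCast, zpow_natCast, div_pow, inv_div]
      have := pow_ne_zero m hPv.1
      field_simp
    rw [hxm, hPm, Finset.sum_mul, Finset.sum_mul]
    refine Finset.sum_congr rfl fun l _ => ?_
    have e1 : b + (t + a * l) = (b + t) + a * l := by ring
    have e2 : d - (t + a * l) + a * m = (d - t) + (a * m - a * l) := by ring
    rw [e1, e2, zpow_add₀ (hx0 _) (b + t), zpow_add₀ (hx0 _) (d - t), nsmul_eq_mul]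
    ring
  have hg : ∀ t, g t = ∑ l ∈ Finset.range (m + 1), m.choose l • g' (t + a * l) := by
    intro t
    have : g t = c v (Ψ (mon x (tri v m (b + t) (d - t)))) :=
      (hcc v _ (hL _ (mon_mem_laurent x _))).symm
    rw [this, hmon]
    simp only [map_sum, map_nsmul]
    rfl
  obtain ⟨t₁, t₂, ht₁, ht₂, hle⟩ := exists_wide_support hg'fin (by omega) hg
    ⟨0, by simpa [g, hα] using hαS.1⟩
  have hmem : ∀ t, g t ≠ 0 → tri v m (b + t) (d - t) ∈ S := fun t ht =>
    ⟨ht, by rw [sum_tri]; linarith⟩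
  have i1 := hmax _ (hmem t₂ ht₂) (v + 1)
  have i2 := hmax _ (hmem t₁ ht₁) (v + 2)
  rw [tri_one] at i1
  rw [tri_two] at i2
  have ha' : (3 : ℤ) ≤ a := by exact_mod_cast ha
  -- Adding `b + t₂ ≤ m` and `d - t₁ ≤ m` to `t₂ - t₁ ≥ a * m` and `m + b + d = 1` gives `a * m + 1
  -- ≤ 3 * m`.
  nlinarith

/-! ### Extension to the fraction field and to Laurent rings -/

/-- A Frobenius-inverse linear endomorphism of a subalgebra extends to the fraction field. -/
theorem exists_extension {k F : Type*} [Field k] [Field F] [Algebra k F] (A : Subalgebra k F)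
    (hfrac : ∀ z : F, ∃ s ∈ A, s ≠ 0 ∧ s * z ∈ A) {q : ℕ} (hq : 0 < q) (ψ : A →+ A)
    (hψ : ∀ r y, ψ (r ^ q * y) = r * ψ y) :
    ∃ Ψ : F →+ F, (∀ y : A, Ψ y = ψ y) ∧ ∀ r z, Ψ (r ^ q * z) = r * Ψ z := by
  choose s hsA hs0 hsz using hfrac
  have hsq : ∀ z, s z ^ q * z ∈ A := fun z => by
    obtain ⟨q, rfl⟩ := Nat.exists_eq_succ_of_ne_zero hq.ne'
    rw [pow_succ, mul_assoc]
    exact A.mul_mem (A.pow_mem (hsA z) q) (hsz z)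
  have hψ' : ∀ r (_ : r ∈ A) y (hy : y ∈ A) (hry : r ^ q * y ∈ A),
      (ψ ⟨r ^ q * y, hry⟩ : F) = r * ψ ⟨y, hy⟩ := fun r hr y hy hry =>
    congrArg Subtype.val (hψ ⟨r, hr⟩ ⟨y, hy⟩)
  -- Forced by `Ψ (s ^ q * z) = s * Ψ z`; `hf` shows that the denominator `s` does not matter.
  let f : F → F := fun z => ψ ⟨s z ^ q * z, hsq z⟩ / s z
  have hf : ∀ z t, t ∈ A → t ≠ 0 → ∀ h : t ^ q * z ∈ A, f z = ψ ⟨t ^ q * z, h⟩ / t := by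
    intro z t ht ht0 h
    have e1 := hψ' (s z) (hsA z) _ h (A.mul_mem (A.pow_mem (hsA z) q) h)
    have e2 := hψ' t ht _ (hsq z) (A.mul_mem (A.pow_mem ht q) (hsq z))
    have e3 : s z ^ q * (t ^ q * z) = t ^ q * (s z ^ q * z) := by ring
    simp only [e3] at e1
    rw [div_eq_div_iff (hs0 z) ht0, mul_comm, ← e2, e1, mul_comm]
  refine ⟨AddMonoidHom.mk' f fun y z => ?_, fun y => ?_, fun r z => ?_⟩
  · have ht := A.mul_mem (hsA y) (hsA z)
    have ht0 := mul_ne_zero (hs0 y) (hs0 z)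
    have hy : (s y * s z) ^ q * y ∈ A := by
      rw [mul_pow, mul_right_comm]
      exact A.mul_mem (hsq y) (A.pow_mem (hsA z) q)
    have hz : (s y * s z) ^ q * z ∈ A := by
      rw [mul_pow, mul_assoc]
      exact A.mul_mem (A.pow_mem (hsA y) q) (hsq z)
    have hyz : (s y * s z) ^ q * (y + z) ∈ A := by
      rw [mul_add]
      exact A.add_mem hy hz
    rw [hf _ _ ht ht0 hy, hf _ _ ht ht0 hz, hf _ _ ht ht0 hyz, ← add_div, ← A.coe_add, ← map_add]
    simp only [mul_add]
    rfl
  · have h : (1 : F) ^ q * y ∈ A := by simp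
    change f y = _
    rw [hf _ 1 A.one_mem one_ne_zero h, div_one]
    simp
  · have ht := A.mul_mem (hsA r) (hsA z)
    have ht0 := mul_ne_zero (hs0 r) (hs0 z)
    have e : (s r * s z) ^ q * (r ^ q * z) = (s r * r) ^ q * (s z ^ q * z) := by ring
    have h : (s r * r) ^ q * (s z ^ q * z) ∈ A := A.mul_mem (A.pow_mem (hsz r) q) (hsq z)
    have h' : (s r * s z) ^ q * (r ^ q * z) ∈ A := e ▸ h
    change f (r ^ q * z) = r * f z
    rw [hf _ _ ht ht0 h']
    simp only [e]
    rw [hψ' _ (hsz r) _ (hsq z)]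
    simp only [f]
    have := hs0 r
    have := hs0 z
    field_simp

/-- With `w` the product of the `y i`, some `(w ^ n) ^ q * z` lies in `A`. Its image `w ^ n * Ψ z`
lies in `A`, hence in the Laurent ring, where `w` is a unit. -/
theorem preserves_laurent {k F : Type*} [Field k] [Field F] [Algebra k F] {A : Subalgebra k F}
    {ι : Type*} [Fintype ι] {y : ι → F} (hy0 : ∀ i, y i ≠ 0) (hy : ∀ i, y i ∈ A)
    (hA : A ≤ laurent k y) {q : ℕ} (hq : 0 < q) (Ψ : F →+ F) (hΨA : ∀ z ∈ A, Ψ z ∈ A)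
    (hΨ : ∀ r z, Ψ (r ^ q * z) = r * Ψ z) {z : F} (hz : z ∈ laurent k y) :
    Ψ z ∈ laurent k y := by
  classical
  have hw : ∏ i, y i ∈ A := prod_mem fun i _ => hy i
  have hw0 : ∏ i, y i ≠ 0 := Finset.prod_ne_zero_iff.mpr fun i _ => hy0 i
  obtain ⟨n, hn⟩ : z ∈ away A _ hw := by
    refine laurent_le (fun i => le_away _ _ hw (hy i)) (fun i => mem_away ?_) hz
    rw [← Finset.mul_prod_erase _ _ (Finset.mem_univ i), inv_mul_cancel_left₀ (hy0 i)]
    exact prod_mem fun j _ => hy j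
  have hwi : (∏ i, y i)⁻¹ ∈ laurent k y := by
    rw [← Finset.prod_inv_distrib]
    exact prod_mem fun i _ => inv_mem_laurent y i
  generalize ∏ i, y i = w at *
  have hq1 : w ^ n * w ^ (n * (q - 1)) = (w ^ n) ^ q := by
    rw [← pow_add, ← pow_mul]
    congr 1
    obtain ⟨q, rfl⟩ := Nat.exists_eq_succ_of_ne_zero hq.ne'
    simp
    ring
  have h1 : (w ^ n) ^ q * z ∈ A := by
    rw [← hq1, mul_comm, ← mul_assoc]
    exact A.mul_mem hn (A.pow_mem hw _)
  have h2 := hA (hΨA _ h1)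
  rw [hΨ] at h2
  have h3 := mul_mem (pow_mem hwi n) h2
  rwa [inv_pow, inv_mul_cancel_left₀ (pow_ne_zero n hw0)] at h3

end LaurentPhenomenon

/-! ### Failure of strong F-regularity -/

namespace LaurentPhenomenon

theorem not_stronglyFRegular_of_forall_ne_one {p : ℕ} [Fact p.Prime] {R : Type*} [CommRing R]
    [IsDomain R] [CharP R p] {c : R} (hc : c ≠ 0)
    (h : ∀ q : ℕ, 0 < q → ∀ ψ : R →+ R, (∀ r y, ψ (r ^ q * y) = r * ψ y) → ψ c ≠ 1) :
    ¬ FrobeniusRegularity.StronglyFRegular p R := by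
  intro hreg
  obtain ⟨e, ψ, hψ⟩ := hreg c hc
  exact h (p ^ e) (pow_pos (Fact.out : p.Prime).pos e)
    (ψ.toAddMonoidHom.comp
      (FrobeniusRegularity.FrobeniusRoot.root R p e).toAddEquiv.toAddMonoidHom)
    (fun r y => ψ.map_smul r (FrobeniusRegularity.FrobeniusRoot.root R p e y)) hψ

/-- A subalgebra that contains a cluster and the three adjacent ones, and consists of Laurent
polynomials in each of these four, has no Frobenius-inverse linear map that takes a cluster
variable to `1`. -/
theorem ne_one_of_le_laurent {k F : Type*} [Field k] [Field F] [Algebra k F] {a : ℕ}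
    (ha : 3 ≤ a) {x : Fin 3 → F} (hx : AlgebraicIndependent k x)
    (hgen : IntermediateField.adjoin k (Set.range x) = ⊤) (hy0 : ∀ v i, exchange a x v i ≠ 0)
    (A : Subalgebra k F) (hxA : ∀ i, x i ∈ A) (hyA : ∀ v i, exchange a x v i ∈ A)
    (hAx : A ≤ laurent k x) (hAy : ∀ v, A ≤ laurent k (exchange a x v)) (i : Fin 3) {q : ℕ}
    (hq : 0 < q) (ψ : A →+ A) (hψ : ∀ r y, ψ (r ^ q * y) = r * ψ y) : ψ ⟨x i, hxA i⟩ ≠ 1 := by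
  have hx0 : ∀ i, x i ≠ 0 := hx.ne_zero
  have hfrac : ∀ z : F, ∃ s ∈ A, s ≠ 0 ∧ s * z ∈ A := by
    intro z
    have hle : Algebra.adjoin k (Set.range x) ≤ A := by
      refine Algebra.adjoin_le ?_
      rintro _ ⟨i, rfl⟩
      exact hxA i
    have hz : z ∈ IntermediateField.adjoin k (Set.range x) := hgen ▸ IntermediateField.mem_top
    obtain ⟨r, hr, s, hs, rfl⟩ := IntermediateField.mem_adjoin_iff_div.mp hz
    by_cases h : s = 0
    · exact ⟨1, one_mem _, one_ne_zero, by simp [h]⟩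
    · exact ⟨s, hle hs, h, by rw [mul_div_cancel₀ _ h]; exact hle hr⟩
  obtain ⟨Ψ, hΨA, hΨ⟩ := exists_extension A hfrac hq ψ hψ
  have hΨA' : ∀ z ∈ A, Ψ z ∈ A := fun z hz => by
    rw [hΨA ⟨z, hz⟩]
    exact (ψ _).2
  intro h1
  refine ne_one_of_preserves_laurent ha hx (fun v => hy0 v v) hq Ψ hΨ
    (fun z => preserves_laurent hx0 hxA hAx hq Ψ hΨA' hΨ)
    (fun v z => preserves_laurent (hy0 v) (hyA v) (hAy v) hq Ψ hΨA' hΨ) i ?_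
  rw [hΨA ⟨x i, hxA i⟩, h1]
  rfl

theorem isWild_const {a : ℕ} (ha : 3 ≤ a) : IsWild fun _ => a := by
  refine ⟨fun _ => ha, ?_⟩
  nlinarith [Nat.mul_le_mul_left (a * a) ha]

theorem records_markovSeed {k F : Type*} [Field k] [Field F] [Algebra k F] {a : ℕ} (ha : 2 ≤ a)
    (x : Fin 3 → F) (hx : AlgebraicIndependent k x)
    (hgen : IntermediateField.adjoin k (Set.range x) = ⊤) :
    Records (ClusterAlgebra.markovSeed a ha x hx hgen) (x, fun _ => a) := by
  refine ⟨rfl, rfl, Or.inl fun i => ?_⟩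
  fin_cases i <;> simp [ClusterAlgebra.markovSeed, ClusterAlgebra.markovQuiver]

theorem mutateTriple_const {F : Type*} [Field F] (a : ℕ) (x : Fin 3 → F) (v : Fin 3) :
    (mutateTriple (x, fun _ => a) v).1 = exchange a x v := by
  simp only [mutateTriple, exchange]

theorem not_stronglyFRegular_of_records (p : ℕ) [Fact p.Prime] {k F : Type*} [Field k]
    [CharP k p] [Field F] [Algebra k F] {a : ℕ} (ha : 3 ≤ a) {x : Fin 3 → F}
    (hx : AlgebraicIndependent k x) (hgen : IntermediateField.adjoin k (Set.range x) = ⊤)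
    {S : ClusterAlgebra.Seed k F (Fin 3)} (hS : Records S (x, fun _ => a)) :
    ¬ FrobeniusRegularity.StronglyFRegular p S.clusterAlgebra := by
  have hwild : IsWild (x, fun _ : Fin 3 => a).2 := isWild_const ha
  have hadm : Admissible k (x, fun _ : Fin 3 => a) := ⟨hwild, S, hS⟩
  have hxA : ∀ i, x i ∈ S.clusterAlgebra := fun i => by
    have := mem_clusterAlgebra (S := S) i
    rwa [hS.x_eq] at this
  have hne : (⟨x 0, hxA 0⟩ : S.clusterAlgebra) ≠ 0 := fun h =>
    hx.ne_zero 0 (congrArg Subtype.val h)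
  have hy0 : ∀ v i, exchange a x v i ≠ 0 := fun v i => by
    rw [← mutateTriple_const]
    exact (hadm.mutate v).ne_zero i
  have hyA : ∀ v i, exchange a x v i ∈ S.clusterAlgebra := fun v i => by
    rw [← mutateTriple_const]
    exact mutate_mem_clusterAlgebra (D := (x, fun _ => a)) hwild hS v i
  have hAx : S.clusterAlgebra ≤ laurent k x := clusterAlgebra_le_laurent (D := (x, fun _ => a)) hwild hS
  have hAy : ∀ v, S.clusterAlgebra ≤ laurent k (exchange a x v) := fun v => by
    rw [← mutateTriple_const]
    exact clusterAlgebra_le_laurent_mutate (D := (x, fun _ => a)) hwild hS v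
  exact not_stronglyFRegular_of_forall_ne_one hne fun q hq ψ hψ =>
    ne_one_of_le_laurent ha hx hgen hy0 _ hxA hyA hAx hAy 0 hq ψ hψ

end LaurentPhenomenon

theorem mainTheorem8 (p : ℕ) [Fact p.Prime] {k F : Type*} [Field k] [CharP k p]
    [Field F] [Algebra k F] (a : ℕ) (ha : 3 ≤ a) (x : Fin 3 → F)
    (hx : AlgebraicIndependent k x)
    (hgen : IntermediateField.adjoin k (Set.range x) = ⊤) :
    ¬ FrobeniusRegularity.StronglyFRegular p
        (ClusterAlgebra.markovSeed a (le_trans (by norm_num) ha) x hx hgen).clusterAlgebra := by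
  exact LaurentPhenomenon.not_stronglyFRegular_of_records p ha hx hgen
    (LaurentPhenomenon.records_markovSeed _ x hx hgen)
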